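/- Let $\Omega\subset\mathbb R^d$ be a domain (open and connected; $d=2,3$ are the cases of interest, but $d$ is arbitrary). For a velocity field $u$ put $\varepsilon(u)=\frac12(\nabla u+\nabla u^{T})$ and $\varepsilon_{II}(u)=(\frac12\,\varepsilon(u):\varepsilon(u))^{1/2}$. Let $\mu_r,\tau_y:\Omega\to(0,\infty)$ be measurable (reference viscosity and yield stress, possibly depending on $x$), let $\underline\mu\ge 0$ be a constant and let $f\in L^2(\Omega)^d$. Consider the nonlinear Stokes problem $$-\nabla\cdot[\mu(u)(\nabla u+\nabla u^T)]+\nabla p=f,\qquad \nabla\cdot u=0\quad\text{in }\Omega,\qquad u=0\ \text{on }\partial\Omega,$$ with the ideal viscosity $\mu_i(u)=\underline\mu+\min\bigl(\tau_y/(2\varepsilon_{II}(u)),\mu_r\bigr)$ (the minimum being $\mu_r$ where $\varepsilon_{II}(u)=0$), or with the composite viscosity $\mu_c(u)=\tau_y\mu_r/(2\varepsilon_{II}(u)\mu_r+\tau_y)$, in which case $\underline\mu=0$ is assumed. Correspondingly let $\varphi=\varphi_i$ or $\varphi=\varphi_c$, where for $\sigma\ge0$ $$\varphi_i(\sigma)=\begin{cases}2\mu_r\sigma^2+\dfrac{\tau_y^2}{2\mu_r}&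 2\mu_r\sigma\le\tau_y,\\ 2\tau_y\sigma&\text{otherwise,}\end{cases}\qquad \varphi_c(\sigma)=2\tau_y\sigma-\frac{\tau_y^2}{\mu_r}\log(\tau_y+2\mu_r\sigma).$$ Assume $\tau_y\in L^2(\Omega)$ and that $\varphi(0)$, as a function of $x$, is integrable over $\Omega$ (both hold, for instance, if $\Omega$ is bounded and $\mu_r,\tau_y$ are constants). Let $H^1_0(\Omega)^d$ be the closure of $C_c^\infty(\Omega)^d$ in $H^1(\Omega)^d$, let $V=\{u\in H^1_0(\Omega)^d:\nabla\cdot u=0\}$, and put $$\Phi(u)=\int_\Omega\varphi(\varepsilon_{II}(u))\,dx+2\underline\mu\int_\Omega\varepsilon_{II}(u)^2\,dx-\int_\Omega f\cdot u\,dx .$$ Call $u\in V$ a velocity solution if $\int_\Omega\mu(u)(\nabla u+\nabla u^T):\nabla v\,dx=\int_\Omega f\cdot v\,dx$ for all $v\in V$, where $\mu=\mu_i$ or $\mu_c$. Then: 1. For constants $\mu_r,\tau_y>0$ both functions $\varphi$ are convex and $C^1$ on $[0,\infty)$, with $\varphi_i'(\sigma)=2\min(2\mu_r\sigma,\tau_y)$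 and $\varphi_c'(\sigma)=4\mu_r\tau_y\sigma/(2\mu_r\sigma+\tau_y)$; and $\varphi'(\sigma)/(2\sigma)+2\underline\mu$ equals twice the corresponding viscosity at $\varepsilon_{II}=\sigma>0$. 2. All integrals above and below converge for $u,v\in H^1_0(\Omega)^d$, and $\Phi$ is convex on $H^1_0(\Omega)^d$. 3. At every $u\in H^1_0(\Omega)^d$ the functional $\Phi$ has a Gateaux derivative $\Phi'(u)$, a bounded linear functional on $H^1_0(\Omega)^d$, and for all $v\in H^1_0(\Omega)^d$ (in particular for all $v \in V$) $$\Phi'(u)v=\int_\Omega\varphi'(\varepsilon_{II}(u))\frac{\varepsilon(u):\varepsilon(v)}{2\varepsilon_{II}(u)}\,dx+\int_\Omega2\underline\mu\,\varepsilon(u):\varepsilon(v)\,dx-\int_\Omega f\cdot v\,dx=\int_\Omega\mu(u)(\nabla u+\nabla u^T):\nabla v\,dx-\int_\Omega f\cdot v\,dx,$$ the first integrand being $0$ where $\varepsilon(u)=0$. 4. For $u\in H^1_0(\Omega)^d$ the following are equivalent: $u$ is a velocity solution; $u$ is a critical point of $\Phi$ over $V$, i.e. $u\in V$ and $\Phi'(u)v=0$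 for all $v\in V$; $u\in V$ and $u$ minimizes $\Phi$ over $V$. 5. If $u\in V$ and $p\in L^2(\Omega)$ satisfy the momentum equation in the sense of distributions on $\Omega$, then $u$ is a velocity solution. -/

import Mathlib

open MeasureTheory TopologicalSpace
open scoped Distributions ContDiff

noncomputable section

namespace Viscoplastic

/-- Euclidean space `ℝ^d`, the space of points and of velocities. -/
abbrev Vec (d : ℕ) := EuclideanSpace ℝ (Fin d)

/-- Jacobians of velocity fields, as linear maps. -/
abbrev Jac (d : ℕ) := Vec d →L[ℝ] Vec d

/-- Pairs (velocity, gradient) in `L²(Ω)^d × L²(Ω)^{d × d}`. -/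
abbrev L2Pair {d : ℕ} (Ω : Opens (Vec d)) :=
  Lp (Vec d) 2 (volume.restrict (Ω : Set (Vec d))) ×
    Lp (Jac d) 2 (volume.restrict (Ω : Set (Vec d)))

/-- The matrix `(∇u)_{ij} = ∂_j u_i` of a Jacobian. -/
def gradMatrix {d : ℕ} (G : Jac d) : Matrix (Fin d) (Fin d) ℝ :=
  Matrix.of fun i j => G (EuclideanSpace.single j 1) i

/-- The inner product `A : B` of second-order tensors. -/
def contraction {d : ℕ} (A B : Matrix (Fin d) (Fin d) ℝ) : ℝ := ∑ i, ∑ j, A i j * B i j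

/-- The strain rate tensor `ε = (∇u + ∇uᵀ) / 2`. -/
def strainRate {d : ℕ} (M : Matrix (Fin d) (Fin d) ℝ) : Matrix (Fin d) (Fin d) ℝ :=
  (1 / 2 : ℝ) • (M + M.transpose)

/-- The second invariant `ε_II = (ε : ε / 2)^{1/2}`. -/
def secondInvariant {d : ℕ} (e : Matrix (Fin d) (Fin d) ℝ) : ℝ :=
  Real.sqrt (1 / 2 * contraction e e)

/-! ### The Sobolev spaces `H¹(Ω)^d` and `H¹₀(Ω)^d` -/

/-- `G` is the weak gradient of `u` on `Ω`:
`∫_Ω u_i ∂_j ψ = - ∫_Ω G_{ij} ψ` for all test functions `ψ`. -/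
def IsWeakGradient {d : ℕ} (Ω : Opens (Vec d)) (w : L2Pair Ω) : Prop :=
  ∀ (ψ : 𝓓(Ω, ℝ)) (i j : Fin d),
    ∫ x in (Ω : Set (Vec d)), w.1 x i * fderiv ℝ ψ x (EuclideanSpace.single j 1) =
      - ∫ x in (Ω : Set (Vec d)), gradMatrix (w.2 x) i j * ψ x

lemma integrable_coord_mul_test {d : ℕ} (Ω : Opens (Vec d)) (w : L2Pair Ω)
    (ψ : 𝓓(Ω, ℝ)) (i j : Fin d) :
    Integrable (fun x => w.1 x i * fderiv ℝ ψ x (EuclideanSpace.single j 1))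
      (volume.restrict (Ω : Set (Vec d))) := by
  have h1 : MemLp (fun x => w.1 x i) 2 (volume.restrict (Ω : Set (Vec d))) :=
    (EuclideanSpace.proj i : Vec d →L[ℝ] ℝ).comp_memLp' (Lp.memLp w.1)
  have h2 : MemLp (fun x => fderiv ℝ ψ x (EuclideanSpace.single j 1)) 2
      (volume.restrict (Ω : Set (Vec d))) :=
    Continuous.memLp_of_hasCompactSupport
      ((ψ.contDiff.continuous_fderiv (by simp)).clm_apply continuous_const)
      (ψ.hasCompactSupport.fderiv_apply (𝕜 := ℝ) _)
  exact h1.integrable_mul h2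

lemma integrable_grad_mul_test {d : ℕ} (Ω : Opens (Vec d)) (w : L2Pair Ω)
    (ψ : 𝓓(Ω, ℝ)) (i j : Fin d) :
    Integrable (fun x => gradMatrix (w.2 x) i j * ψ x)
      (volume.restrict (Ω : Set (Vec d))) := by
  have h1 : MemLp (fun x => gradMatrix (w.2 x) i j) 2 (volume.restrict (Ω : Set (Vec d))) :=
    ((EuclideanSpace.proj i : Vec d →L[ℝ] ℝ).comp
      (ContinuousLinearMap.apply ℝ (Vec d)
        (EuclideanSpace.single j 1 : Vec d))).comp_memLp' (Lp.memLp w.2)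
  have h2 : MemLp (fun x => ψ x) 2 (volume.restrict (Ω : Set (Vec d))) :=
    Continuous.memLp_of_hasCompactSupport ψ.continuous ψ.hasCompactSupport
  exact h1.integrable_mul h2

/-- `H¹(Ω)^d`, each field being paired with its weak gradient. -/
def H1 {d : ℕ} (Ω : Opens (Vec d)) : Submodule ℝ (L2Pair Ω) where
  carrier := {w | IsWeakGradient Ω w}
  zero_mem' := by
    intro ψ i j
    have h1 := Lp.coeFn_zero (Vec d) 2 (volume.restrict (Ω : Set (Vec d)))
    have h2 := Lp.coeFn_zero (Jac d) 2 (volume.restrict (Ω : Set (Vec d)))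
    rw [integral_eq_zero_of_ae, integral_eq_zero_of_ae, neg_zero]
    · filter_upwards [h2] with x hx
      have hx' : (0 : L2Pair Ω).2 x = 0 := hx
      simp only [hx', gradMatrix]
      simp
    · filter_upwards [h1] with x hx
      have hx' : (0 : L2Pair Ω).1 x = 0 := hx
      simp only [hx']
      simp
  add_mem' := by
    intro a b ha hb ψ i j
    have h1 := Lp.coeFn_add a.1 b.1
    have h2 := Lp.coeFn_add a.2 b.2
    have e1 : ∫ x in (Ω : Set (Vec d)), (a + b).1 x i *
          fderiv ℝ ψ x (EuclideanSpace.single j 1) =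
        ∫ x in (Ω : Set (Vec d)), (a.1 x i * fderiv ℝ ψ x (EuclideanSpace.single j 1) +
          b.1 x i * fderiv ℝ ψ x (EuclideanSpace.single j 1)) := by
      refine integral_congr_ae ?_
      filter_upwards [h1] with x hx
      have hx' : (a + b).1 x = a.1 x + b.1 x := hx
      simp only [hx', PiLp.add_apply, add_mul]
    have e2 : ∫ x in (Ω : Set (Vec d)), gradMatrix ((a + b).2 x) i j * ψ x =
        ∫ x in (Ω : Set (Vec d)), (gradMatrix (a.2 x) i j * ψ x +
          gradMatrix (b.2 x) i j * ψ x) := by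
      refine integral_congr_ae ?_
      filter_upwards [h2] with x hx
      have hx' : (a + b).2 x = a.2 x + b.2 x := hx
      simp only [hx', gradMatrix, Matrix.of_apply, _root_.add_apply, PiLp.add_apply, add_mul]
    rw [e1, e2, integral_add (integrable_coord_mul_test Ω a ψ i j)
      (integrable_coord_mul_test Ω b ψ i j), integral_add (integrable_grad_mul_test Ω a ψ i j)
      (integrable_grad_mul_test Ω b ψ i j), ha ψ i j, hb ψ i j]
    ring
  smul_mem' := by
    intro c a ha ψ i j
    have h1 := Lp.coeFn_smul c a.1
    have h2 := Lp.coeFn_smul c a.2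
    have e1 : ∫ x in (Ω : Set (Vec d)), (c • a).1 x i *
          fderiv ℝ ψ x (EuclideanSpace.single j 1) =
        ∫ x in (Ω : Set (Vec d)), c * (a.1 x i *
          fderiv ℝ ψ x (EuclideanSpace.single j 1)) := by
      refine integral_congr_ae ?_
      filter_upwards [h1] with x hx
      simp [hx, mul_assoc]
    have e2 : ∫ x in (Ω : Set (Vec d)), gradMatrix ((c • a).2 x) i j * ψ x =
        ∫ x in (Ω : Set (Vec d)), c * (gradMatrix (a.2 x) i j * ψ x) := by
      refine integral_congr_ae ?_
      filter_upwards [h2] with x hx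
      simp [hx, gradMatrix, mul_assoc]
    rw [e1, e2, integral_const_mul, integral_const_mul, ha ψ i j]
    ring

/-- The smooth compactly supported fields on `Ω`, paired with their gradients. -/
def testFields {d : ℕ} (Ω : Opens (Vec d)) : Submodule ℝ (L2Pair Ω) where
  carrier := {w | ∃ φ : 𝓓(Ω, Vec d),
    w.1 =ᵐ[volume.restrict (Ω : Set (Vec d))] φ ∧
    w.2 =ᵐ[volume.restrict (Ω : Set (Vec d))] fderiv ℝ φ}
  zero_mem' := by
    refine ⟨0, Lp.coeFn_zero _ _ _, ?_⟩
    filter_upwards [Lp.coeFn_zero (Jac d) 2 (volume.restrict (Ω : Set (Vec d)))] with x hx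
    have : fderiv ℝ ((0 : 𝓓(Ω, Vec d)) : Vec d → Vec d) x = 0 := by
      change fderiv ℝ (fun _ => (0 : Vec d)) x = 0
      simp
    rw [this]
    exact hx
  add_mem' := by
    rintro a b ⟨φ, h1, h2⟩ ⟨ψ, h3, h4⟩
    refine ⟨φ + ψ, ?_, ?_⟩
    · filter_upwards [h1, h3, Lp.coeFn_add a.1 b.1] with x e1 e3 e5
      have e6 : (a + b).1 x = a.1 x + b.1 x := e5
      rw [e6, e1, e3]
      rfl
    · filter_upwards [h2, h4, Lp.coeFn_add a.2 b.2] with x e2 e4 e5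
      have : fderiv ℝ (φ + ψ : 𝓓(Ω, Vec d)) x = fderiv ℝ φ x + fderiv ℝ ψ x :=
        fderiv_add ((φ.contDiff.differentiable (by simp)) x)
          ((ψ.contDiff.differentiable (by simp)) x)
      have e6 : (a + b).2 x = a.2 x + b.2 x := e5
      rw [e6, e2, e4, this]
  smul_mem' := by
    rintro c a ⟨φ, h1, h2⟩
    refine ⟨c • φ, ?_, ?_⟩
    · filter_upwards [h1, Lp.coeFn_smul c a.1] with x e1 e5
      simp [e5, e1]
    · filter_upwards [h2, Lp.coeFn_smul c a.2] with x e2 e5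
      have : fderiv ℝ (c • φ : 𝓓(Ω, Vec d)) x = c • fderiv ℝ φ x :=
        fderiv_const_smul ((φ.contDiff.differentiable (by simp)) x) c
      have e6 : (c • a).2 x = c • a.2 x := e5
      rw [e6, e2, this]

/-- `H¹₀(Ω)^d`: the closure in `H¹(Ω)^d` of the smooth compactly supported fields. The `H¹` norm
is equivalent to the norm of `L2Pair Ω`. -/
def H10 {d : ℕ} (Ω : Opens (Vec d)) : Submodule ℝ (L2Pair Ω) :=
  H1 Ω ⊓ (testFields Ω).topologicalClosure

/-- The velocity of an element of `H¹₀(Ω)^d`. -/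
def vel {d : ℕ} {Ω : Opens (Vec d)} (u : H10 Ω) (x : Vec d) : Vec d := u.1.1 x

/-- The weak gradient `∇u`, as a matrix field. -/
def grad {d : ℕ} {Ω : Opens (Vec d)} (u : H10 Ω) (x : Vec d) : Matrix (Fin d) (Fin d) ℝ :=
  gradMatrix (u.1.2 x)

/-- The strain rate `ε(u)`. -/
def strain {d : ℕ} {Ω : Opens (Vec d)} (u : H10 Ω) (x : Vec d) : Matrix (Fin d) (Fin d) ℝ :=
  strainRate (grad u x)

/-- The second invariant `ε_II(u)` of the strain rate. -/
def strainII {d : ℕ} {Ω : Opens (Vec d)} (u : H10 Ω) (x : Vec d) : ℝ :=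
  secondInvariant (strain u x)

/-- The divergence-free fields in `H¹₀(Ω)^d`. -/
def solenoidal {d : ℕ} (Ω : Opens (Vec d)) : Submodule ℝ (H10 Ω) where
  carrier := {u | ∀ᵐ x ∂(volume.restrict (Ω : Set (Vec d))), (grad u x).trace = 0}
  zero_mem' := by
    filter_upwards [Lp.coeFn_zero (Jac d) 2 (volume.restrict (Ω : Set (Vec d)))] with x hx
    have hx' : (0 : H10 Ω).1.2 x = 0 := hx
    simp only [grad, hx']
    simp [gradMatrix, Matrix.trace]
  add_mem' := by
    rintro a b ha hb
    filter_upwards [ha, hb, Lp.coeFn_add a.1.2 b.1.2] with x h1 h2 h3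
    simp only [grad, gradMatrix, Matrix.trace, Matrix.diag_apply, Matrix.of_apply] at h1 h2 ⊢
    have h4 : (a + b).1.2 x = a.1.2 x + b.1.2 x := h3
    simp only [h4, _root_.add_apply, PiLp.add_apply, Finset.sum_add_distrib, h1, h2, add_zero]
  smul_mem' := by
    rintro c a ha
    filter_upwards [ha, Lp.coeFn_smul c a.1.2] with x h1 h3
    simp only [grad, gradMatrix, Matrix.trace, Matrix.diag_apply, Matrix.of_apply] at h1 ⊢
    simp [h3, ← Finset.mul_sum, h1]

/-! ### The two rheologies -/

/-- Ideal or composite von Mises rheology. -/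
inductive Rheology
  | ideal
  | composite

/-- The effective viscosity at second invariant `s ≥ 0`, with lower bound `m`, reference
viscosity `r` and yield stress `y`. In the ideal law `y / (2 s)` is `+∞` for `s = 0`, so that the
minimum is `r` there. -/
def viscosity (m r y s : ℝ) : Rheology → ℝ
  | .ideal => m + if s = 0 then r else min (y / (2 * s)) r
  | .composite => y * r / (2 * s * r + y)

/-- The functions `φ_i` and `φ_c`. -/
def phi (r y s : ℝ) : Rheology → ℝ
  | .ideal => if 2 * r * s ≤ y then 2 * r * s ^ 2 + y ^ 2 / (2 * r) else 2 * y * s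
  | .composite => 2 * y * s - y ^ 2 / r * Real.log (y + 2 * r * s)

/-- The expressions for the derivatives `φ_i'` and `φ_c'`. -/
def phiDeriv (r y s : ℝ) : Rheology → ℝ
  | .ideal => 2 * min (2 * r * s) y
  | .composite => 4 * r * y * s / (2 * r * s + y)

/-! ### Energy, first variation and weak form -/

/-- The energy `Φ(u) = ∫ φ(ε_II(u)) + 2 m ∫ ε_II(u)² - ∫ f · u`. -/
def energy {d : ℕ} (Ω : Opens (Vec d)) (law : Rheology) (m : ℝ) (μr τy : Vec d → ℝ)
    (f : Vec d → Vec d) (u : H10 Ω) : ℝ :=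
  (∫ x in (Ω : Set (Vec d)), phi (μr x) (τy x) (strainII u x) law)
    + 2 * m * (∫ x in (Ω : Set (Vec d)), strainII u x ^ 2)
    - ∫ x in (Ω : Set (Vec d)), inner ℝ (f x) (vel u x)

/-- The integrand `φ'(ε_II(u)) ε(u):ε(v) / (2 ε_II(u))`, which is zero where `ε(u) = 0`. -/
def phiVariation {d : ℕ} {Ω : Opens (Vec d)} (law : Rheology) (μr τy : Vec d → ℝ)
    (u v : H10 Ω) (x : Vec d) : ℝ :=
  phiDeriv (μr x) (τy x) (strainII u x) law *
    (contraction (strain u x) (strain v x) / (2 * strainII u x))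

/-- The expression
`∫ φ'(ε_II(u)) ε(u):ε(v) / (2 ε_II(u)) + ∫ 2 m ε(u):ε(v) - ∫ f · v`. -/
def firstVariation {d : ℕ} (Ω : Opens (Vec d)) (law : Rheology) (m : ℝ) (μr τy : Vec d → ℝ)
    (f : Vec d → Vec d) (u v : H10 Ω) : ℝ :=
  (∫ x in (Ω : Set (Vec d)), phiVariation law μr τy u v x)
    + (∫ x in (Ω : Set (Vec d)), 2 * m * contraction (strain u x) (strain v x))
    - ∫ x in (Ω : Set (Vec d)), inner ℝ (f x) (vel v x)

/-- The stress `μ(u) (∇u + ∇uᵀ)`. -/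
def stress {d : ℕ} {Ω : Opens (Vec d)} (law : Rheology) (m : ℝ) (μr τy : Vec d → ℝ)
    (u : H10 Ω) (x : Vec d) : Matrix (Fin d) (Fin d) ℝ :=
  viscosity m (μr x) (τy x) (strainII u x) law • (grad u x + (grad u x).transpose)

/-- `∫ μ(u) (∇u + ∇uᵀ) : ∇v - ∫ f · v`, the residual of the weak momentum equation tested with
a divergence-free field `v`. -/
def weakResidual {d : ℕ} (Ω : Opens (Vec d)) (law : Rheology) (m : ℝ) (μr τy : Vec d → ℝ)
    (f : Vec d → Vec d) (u v : H10 Ω) : ℝ :=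
  (∫ x in (Ω : Set (Vec d)), contraction (stress law m μr τy u x) (grad v x))
    - ∫ x in (Ω : Set (Vec d)), inner ℝ (f x) (vel v x)

/-- `u` is a velocity solution of the nonlinear Stokes problem: `u ∈ H¹₀(Ω)^d` is divergence-free
and satisfies the weak momentum equation for all divergence-free test fields in `H¹₀(Ω)^d`. -/
def IsVelocitySolution {d : ℕ} (Ω : Opens (Vec d)) (law : Rheology) (m : ℝ)
    (μr τy : Vec d → ℝ) (f : Vec d → Vec d) (u : H10 Ω) : Prop :=
  u ∈ solenoidal Ω ∧ ∀ v ∈ solenoidal Ω, weakResidual Ω law m μr τy f u v = 0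

/-- `(u, p)` solves the nonlinear Stokes system `-∇·[μ(u)(∇u + ∇uᵀ)] + ∇p = f`, `∇·u = 0`
in the sense of distributions. -/
def IsStokesPair {d : ℕ} (Ω : Opens (Vec d)) (law : Rheology) (m : ℝ)
    (μr τy : Vec d → ℝ) (f : Vec d → Vec d) (u : H10 Ω) (p : Vec d → ℝ) : Prop :=
  u ∈ solenoidal Ω ∧ ∀ v : 𝓓(Ω, Vec d),
    (∫ x in (Ω : Set (Vec d)), contraction (stress law m μr τy u x) (gradMatrix (fderiv ℝ v x)))
      - (∫ x in (Ω : Set (Vec d)), p x * (gradMatrix (fderiv ℝ v x)).trace)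
      = ∫ x in (Ω : Set (Vec d)), inner ℝ (f x) (v x)

/-- `u` is a critical point of `Φ` over the subspace `V`. -/
def IsCriticalPoint {X : Type*} [AddCommGroup X] [Module ℝ X] (Φ : X → ℝ) (V : Submodule ℝ X)
    (u : X) : Prop :=
  u ∈ V ∧ ∀ v ∈ V, HasLineDerivAt ℝ Φ 0 u v

end Viscoplastic

end

namespace Viscoplastic

/-! ### The functions `φ_i` and `φ_c` -/

section Rheology

variable (law : Rheology) {r y : ℝ}

/-! The map `strainVec`, which sends a Jacobian to `ε / √2`, is linear, and its Euclidean norm is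
`ε_II`. With `a = strainVec (∇u)` the energy is `∫ φ(‖a‖) + 2m ∫ ‖a‖²` minus a linear term, so
everything rests on scalar facts about `φ`: it is convex, `φ'(0) = 0` and `0 ≤ φ' ≤ 2τ_y`.

Monotonicity and convexity make `φ(‖·‖)` convex, hence `Φ` convex. The slope bound makes `t ↦ φ(‖a +
t b‖)` Lipschitz with constant `2τ_y‖b‖`, which is integrable because `τ_y` and `b` are in `L²`;
this gives convergence of the integrals (starting from `φ(0)`) and differentiation under the
integral sign. The condition `φ'(0) = 0` removes the singularity of the norm at the origin.

The identity `φ'(s)/(2s) + 2m = 2μ(s)` (`phiDeriv_div_add`) turns the derivative into the weak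
momentum equation. It also yields `μ(s) s ≤ τ_y + m s`, so the stress is in `L²` and the derivative
is bounded. Convexity then identifies critical points with minimizers. The pressure disappears by
density: the momentum equation extends by continuity from test fields to their closure, where a
divergence-free field annihilates the pressure term. -/

lemma hasDerivAt_phi (hr : 0 < r) (hy : 0 < y) {s : ℝ} (hs : 0 ≤ s) :
    HasDerivAt (fun s => phi r y s law) (phiDeriv r y s law) s := by
  cases law with
  | ideal =>
    have hA : HasDerivAt (fun s : ℝ => 2 * r * s ^ 2 + y ^ 2 / (2 * r)) (2 * (2 * r * s)) s := by
      refine (((hasDerivAt_id s).pow 2).const_mul (2 * r) |>.add_const _).congr_deriv ?_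
      simp; ring
    have hB : HasDerivAt (fun s : ℝ => 2 * y * s) (2 * y) s := by
      simpa using (hasDerivAt_id s).const_mul (2 * y)
    rcases lt_trichotomy (2 * r * s) y with h | h | h
    · simp only [phiDeriv, min_eq_left h.le]
      refine hA.congr_of_eventuallyEq ?_
      have : ∀ᶠ t in nhds s, 2 * r * t < y :=
        (continuous_const.mul continuous_id).continuousAt.eventually_lt_const h
      filter_upwards [this] with t ht
      simp [phi, ht.le]
    -- At the yield threshold both branches have value `y² / r` and slope `2y`, so the one-sided
    -- derivatives glue.
    · simp only [phiDeriv, h, min_self]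
      rw [h] at hA
      have h1 : HasDerivWithinAt (fun s => phi r y s .ideal) (2 * y) (Set.Iic s) s := by
        refine hA.hasDerivWithinAt.congr_of_mem (fun t ht => ?_) Set.self_mem_Iic
        have : 2 * r * t ≤ y := h ▸ mul_le_mul_of_nonneg_left ht (by positivity)
        simp [phi, this]
      have h2 : HasDerivWithinAt (fun s => phi r y s .ideal) (2 * y) (Set.Ici s) s := by
        refine hB.hasDerivWithinAt.congr_of_mem (fun t ht => ?_) Set.self_mem_Ici
        have hle : y ≤ 2 * r * t := h ▸ mul_le_mul_of_nonneg_left ht (by positivity)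
        rcases hle.eq_or_lt with he | hlt
        · simp only [phi, he.ge, if_true]
          rw [he]
          field_simp
          ring
        · simp [phi, not_le.mpr hlt]
      simpa [Set.Iic_union_Ici] using h1.union h2
    · simp only [phiDeriv, min_eq_right h.le]
      refine hB.congr_of_eventuallyEq ?_
      have : ∀ᶠ t in nhds s, y < 2 * r * t :=
        (continuous_const.mul continuous_id).continuousAt.eventually_const_lt h
      filter_upwards [this] with t ht
      simp [phi, not_le.mpr ht]
  | composite =>
    have hpos : 0 < y + 2 * r * s := by positivity
    have h1 : HasDerivAt (fun t : ℝ => y + 2 * r * t) (2 * r) s := by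
      simpa using ((hasDerivAt_id s).const_mul (2 * r)).const_add y
    have h2 : HasDerivAt (fun s : ℝ => 2 * y * s) (2 * y) s := by
      simpa using (hasDerivAt_id s).const_mul (2 * y)
    refine (h2.sub ((h1.log hpos.ne').const_mul (y ^ 2 / r))).congr_deriv ?_
    have : 2 * r * s + y ≠ 0 := by linarith
    simp only [phiDeriv]
    field_simp
    ring

lemma phiDeriv_nonneg (hr : 0 < r) (hy : 0 < y) {s : ℝ} (hs : 0 ≤ s) :
    0 ≤ phiDeriv r y s law := by
  cases law <;> simp only [phiDeriv] <;> positivity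

/-- The yield stress alone caps the slope, so the estimates built on this need no bound on `r`. -/
lemma phiDeriv_le (hr : 0 < r) (hy : 0 < y) {s : ℝ} (hs : 0 ≤ s) :
    phiDeriv r y s law ≤ 2 * y := by
  cases law with
  | ideal => simp [phiDeriv]
  | composite =>
    simp only [phiDeriv]
    rw [div_le_iff₀ (by positivity)]
    nlinarith [mul_pos hy hy]

lemma phiDeriv_zero (hy : 0 < y) : phiDeriv r y 0 law = 0 := by
  cases law <;> simp [phiDeriv, hy.le]

lemma monotoneOn_phiDeriv (hr : 0 < r) (hy : 0 < y) :
    MonotoneOn (fun s => phiDeriv r y s law) (Set.Ici 0) := by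
  intro s hs t ht hst
  simp only [Set.mem_Ici] at hs ht
  cases law with
  | ideal => simp only [phiDeriv]; gcongr
  | composite =>
    simp only [phiDeriv]
    rw [div_le_div_iff₀ (by positivity) (by positivity)]
    have : 0 ≤ 4 * r * y ^ 2 * (t - s) := mul_nonneg (by positivity) (sub_nonneg.2 hst)
    nlinarith

lemma continuousOn_phiDeriv (hr : 0 < r) (hy : 0 < y) :
    ContinuousOn (fun s => phiDeriv r y s law) (Set.Ici 0) := by
  cases law with
  | ideal => simp only [phiDeriv]; fun_prop
  | composite =>
    simp only [phiDeriv]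
    refine ContinuousOn.div (by fun_prop) (by fun_prop) fun s hs => ?_
    have : 0 ≤ s := hs
    positivity

lemma continuousOn_phi (hr : 0 < r) (hy : 0 < y) :
    ContinuousOn (fun s => phi r y s law) (Set.Ici 0) :=
  fun _ hs => (hasDerivAt_phi law hr hy hs).continuousAt.continuousWithinAt

lemma convexOn_phi (hr : 0 < r) (hy : 0 < y) :
    ConvexOn ℝ (Set.Ici 0) (fun s => phi r y s law) := by
  refine MonotoneOn.convexOn_of_deriv (convex_Ici 0) (continuousOn_phi law hr hy) ?_ ?_
  · rw [interior_Ici]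
    exact fun s hs =>
      (hasDerivAt_phi law hr hy (le_of_lt hs)).differentiableAt.differentiableWithinAt
  · rw [interior_Ici]
    refine ((monotoneOn_phiDeriv law hr hy).mono Set.Ioi_subset_Ici_self).congr fun s hs => ?_
    exact (hasDerivAt_phi law hr hy (le_of_lt hs)).deriv.symm

lemma contDiffOn_phi (hr : 0 < r) (hy : 0 < y) :
    ContDiffOn ℝ 1 (fun s => phi r y s law) (Set.Ici 0) := by
  have h0 : (1 : WithTop ℕ∞) = 0 + 1 := by simp
  rw [h0, contDiffOn_succ_iff_derivWithin (uniqueDiffOn_Ici 0)]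
  refine ⟨fun s hs => (hasDerivAt_phi law hr hy hs).differentiableAt.differentiableWithinAt,
    by simp, ?_⟩
  rw [contDiffOn_zero]
  refine (continuousOn_phiDeriv law hr hy).congr fun s hs => ?_
  exact (hasDerivAt_phi law hr hy hs).hasDerivWithinAt.derivWithin (uniqueDiffOn_Ici 0 s hs)

lemma monotoneOn_phi (hr : 0 < r) (hy : 0 < y) :
    MonotoneOn (fun s => phi r y s law) (Set.Ici 0) := by
  refine monotoneOn_of_deriv_nonneg (convex_Ici 0) (continuousOn_phi law hr hy) ?_ ?_ <;>
    rw [interior_Ici]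
  · exact fun s hs =>
      (hasDerivAt_phi law hr hy (le_of_lt hs)).differentiableAt.differentiableWithinAt
  · intro s hs
    rw [(hasDerivAt_phi law hr hy (le_of_lt hs)).deriv]
    exact phiDeriv_nonneg law hr hy (le_of_lt hs)

lemma abs_phi_sub_le (hr : 0 < r) (hy : 0 < y) {s t : ℝ} (hs : 0 ≤ s) (ht : 0 ≤ t) :
    |phi r y t law - phi r y s law| ≤ 2 * y * |t - s| := by
  refine Convex.norm_image_sub_le_of_norm_hasDerivWithin_le (s := Set.Ici 0)
    (f := fun s => phi r y s law)
    (fun x hx => (hasDerivAt_phi law hr hy hx).hasDerivWithinAt) (fun x hx => ?_)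
    (convex_Ici 0) hs ht
  rw [Real.norm_of_nonneg (phiDeriv_nonneg law hr hy hx)]
  exact phiDeriv_le law hr hy hx

lemma phiDeriv_div_add {m s : ℝ} (hm : law = .composite → m = 0) (hr : 0 < r) (hy : 0 < y)
    (hs : 0 < s) : phiDeriv r y s law / (2 * s) + 2 * m = 2 * viscosity m r y s law := by
  cases law with
  | ideal =>
    have : min (y / (2 * s)) r = min (2 * r * s) y / (2 * s) := by
      rw [← min_div_div_right (by positivity : 0 ≤ 2 * s), min_comm]
      congr 1
      field_simp
    simp only [phiDeriv, viscosity, hs.ne', if_false, this]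
    ring
  | composite =>
    -- The composite viscosity contains no term `m`, so the identity holds only for `m = 0`.
    rw [hm rfl]
    have h1 : 2 * r * s + y ≠ 0 := by positivity
    have h2 : 2 * s * r + y ≠ 0 := by positivity
    simp only [phiDeriv, viscosity]
    field_simp
    ring

lemma viscosity_nonneg {m s : ℝ} (h0 : 0 ≤ m) (hr : 0 < r) (hy : 0 < y) (hs : 0 ≤ s) :
    0 ≤ viscosity m r y s law := by
  cases law with
  | ideal =>
    simp only [viscosity]
    split_ifs <;> positivity
  | composite => simp only [viscosity]; positivity

/-- Inserting `φ' ≤ 2y` into `phiDeriv_div_add` bounds the stress by the yield stress plus a linear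
term; this is what places the stress in `L²`. -/
lemma viscosity_mul_le {m s : ℝ} (hm : law = .composite → m = 0) (hr : 0 < r) (hy : 0 < y)
    (hs : 0 ≤ s) : viscosity m r y s law * s ≤ y + m * s := by
  rcases hs.eq_or_lt with rfl | hs
  · simp [hy.le]
  · have h1 := phiDeriv_div_add law hm hr hy hs
    have h2 := phiDeriv_le law hr hy hs.le
    have h3 : phiDeriv r y s law / (2 * s) * (2 * s) = phiDeriv r y s law := by field_simp
    nlinarith

lemma measurable_phi : Measurable fun q : ℝ × ℝ × ℝ => phi q.1 q.2.1 q.2.2 law := by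
  cases law with
  | ideal =>
    simp only [phi]
    exact Measurable.ite (measurableSet_le (by fun_prop) (by fun_prop)) (by fun_prop) (by fun_prop)
  | composite => simp only [phi]; fun_prop

lemma measurable_viscosity (m : ℝ) :
    Measurable fun q : ℝ × ℝ × ℝ => viscosity m q.1 q.2.1 q.2.2 law := by
  cases law with
  | ideal =>
    simp only [viscosity]
    exact measurable_const.add
      (Measurable.ite (measurableSet_eq_fun (by fun_prop) (by fun_prop)) (by fun_prop)
        (by fun_prop))
  | composite => simp only [viscosity]; fun_prop

variable {E : Type*} [NormedAddCommGroup E] [InnerProductSpace ℝ E]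

/-- A convex function of a norm is convex once it is also nondecreasing, which allows the triangle
inequality to be applied inside `φ`. -/
lemma convexOn_phi_norm (hr : 0 < r) (hy : 0 < y) :
    ConvexOn ℝ Set.univ (fun a : E => phi r y ‖a‖ law) := by
  refine ⟨convex_univ, fun a _ b _ s t hs ht hst => ?_⟩
  have h1 : ‖s • a + t • b‖ ≤ s * ‖a‖ + t * ‖b‖ := by
    simpa [norm_smul, abs_of_nonneg hs, abs_of_nonneg ht] using norm_add_le (s • a) (t • b)
  exact (monotoneOn_phi law hr hy (norm_nonneg _)
    (show (0 : ℝ) ≤ s * ‖a‖ + t * ‖b‖ by positivity) h1).trans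
    ((convexOn_phi law hr hy).2 (norm_nonneg a) (norm_nonneg b) hs ht hst)

lemma hasDerivAt_phi_norm_line (hr : 0 < r) (hy : 0 < y) (a b : E) :
    HasDerivAt (fun t : ℝ => phi r y ‖a + t • b‖ law)
      (phiDeriv r y ‖a‖ law * (inner ℝ a b / ‖a‖)) 0 := by
  have hline : HasDerivAt (fun t : ℝ => a + t • b) b 0 := by
    simpa using ((hasDerivAt_id (0 : ℝ)).smul_const b).const_add a
  -- The norm is not differentiable at the origin, but `φ'(0) = 0` gives `φ(‖t b‖) - φ(0) = o(t)`.
  by_cases ha : a = 0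
  · subst ha
    have h0 := hasDerivAt_phi law hr hy (le_refl (0 : ℝ))
    simp only [phiDeriv_zero law hy, norm_zero, zero_mul, zero_add] at h0 ⊢
    rw [hasDerivAt_iff_isLittleO] at h0 ⊢
    have ht : Filter.Tendsto (fun t : ℝ => ‖t • b‖) (nhds 0) (nhds 0) := by
      have : Continuous fun t : ℝ => ‖t • b‖ := by fun_prop
      simpa using this.tendsto 0
    have h1 := h0.comp_tendsto ht
    have h2 : (fun t : ℝ => ‖t • b‖ - 0) =O[nhds 0] fun t : ℝ => t - 0 := by
      refine Asymptotics.IsBigO.of_bound ‖b‖ (Filter.Eventually.of_forall fun t => ?_)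
      simp [norm_smul, mul_comm]
    simpa [Function.comp_def] using h1.trans_isBigO h2
  · have hn : HasDerivAt (fun t : ℝ => ‖a + t • b‖) (inner ℝ a b / ‖a‖) 0 := by
      have h1 := hline.norm_sq
      have h2 := h1.sqrt (by simpa using ha)
      simp only [Real.sqrt_sq (norm_nonneg _), zero_smul, add_zero] at h2
      refine h2.congr_deriv ?_
      rw [mul_div_mul_left _ _ two_ne_zero]
    have h0 := hasDerivAt_phi law hr hy (norm_nonneg (a + (0 : ℝ) • b))
    simpa [Function.comp_def] using h0.comp (0 : ℝ) hn

/-- The constant becomes the dominating function when differentiating under the integral. -/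
lemma lipschitzWith_phi_norm_line (hr : 0 < r) (hy : 0 < y) (a b : E) :
    LipschitzWith (Real.nnabs (2 * y * ‖b‖)) (fun t : ℝ => phi r y ‖a + t • b‖ law) := by
  refine LipschitzWith.of_dist_le_mul fun s t => ?_
  have h1 : |‖a + s • b‖ - ‖a + t • b‖| ≤ |s - t| * ‖b‖ := by
    refine (abs_norm_sub_norm_le _ _).trans_eq ?_
    rw [add_sub_add_left_eq_sub, ← sub_smul, norm_smul, Real.norm_eq_abs]
  rw [Real.dist_eq, Real.dist_eq, Real.coe_nnabs,
    abs_of_nonneg (by positivity : 0 ≤ 2 * y * ‖b‖)]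
  calc |phi r y ‖a + s • b‖ law - phi r y ‖a + t • b‖ law|
      ≤ 2 * y * |‖a + s • b‖ - ‖a + t • b‖| :=
        abs_phi_sub_le law hr hy (norm_nonneg _) (norm_nonneg _)
    _ ≤ 2 * y * (|s - t| * ‖b‖) := by gcongr
    _ = 2 * y * ‖b‖ * |s - t| := by ring

end Rheology

/-! ### Strain rates as vectors of a Euclidean space -/

section Strain

variable {d : ℕ}

/-- The entry `(∇u)_{ij}`, as a continuous linear functional of the Jacobian. -/
noncomputable def gradEntry (i j : Fin d) : Jac d →L[ℝ] ℝ :=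
  (EuclideanSpace.proj i : Vec d →L[ℝ] ℝ).comp
    (ContinuousLinearMap.apply ℝ (Vec d) (EuclideanSpace.single j 1 : Vec d))

lemma gradEntry_apply (i j : Fin d) (G : Jac d) : gradEntry i j G = gradMatrix G i j := rfl

/-- The normalised strain rate `ε / √2` of a Jacobian, as a vector with norm `ε_II`. -/
noncomputable def strainVec (d : ℕ) : Jac d →L[ℝ] EuclideanSpace ℝ (Fin d × Fin d) :=
  LinearMap.toContinuousLinearMap
    { toFun := fun G => WithLp.toLp 2 fun q => √(1 / 2) * strainRate (gradMatrix G) q.1 q.2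
      map_add' := fun G H => by
        ext q
        simp [strainRate, gradMatrix]
        ring
      map_smul' := fun c G => by
        ext q
        simp [strainRate, gradMatrix]
        ring }

lemma strainVec_apply (G : Jac d) (q : Fin d × Fin d) :
    strainVec d G q = √(1 / 2) * strainRate (gradMatrix G) q.1 q.2 := rfl

lemma contraction_strainRate (G H : Jac d) :
    contraction (strainRate (gradMatrix G)) (strainRate (gradMatrix H)) =
      2 * inner ℝ (strainVec d G) (strainVec d H) := by
  have h : √(1 / 2 : ℝ) * √(1 / 2) = 1 / 2 := Real.mul_self_sqrt (by norm_num)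
  simp only [contraction, PiLp.inner_apply, strainVec_apply, Fintype.sum_prod_type,
    Finset.mul_sum]
  refine Finset.sum_congr rfl fun i _ => Finset.sum_congr rfl fun j _ => ?_
  simp only [RCLike.inner_apply, conj_trivial]
  linear_combination (-2 * strainRate (gradMatrix G) i j * strainRate (gradMatrix H) i j) * h

lemma secondInvariant_strainRate (G : Jac d) :
    secondInvariant (strainRate (gradMatrix G)) = ‖strainVec d G‖ := by
  rw [secondInvariant, contraction_strainRate, real_inner_self_eq_norm_sq,
    show 1 / 2 * (2 * ‖strainVec d G‖ ^ 2) = ‖strainVec d G‖ ^ 2 by ring,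
    Real.sqrt_sq (norm_nonneg _)]

lemma abs_symGrad_le (G : Jac d) (i j : Fin d) :
    |(gradMatrix G + (gradMatrix G).transpose) i j| ≤ 4 * ‖strainVec d G‖ := by
  have h1 := PiLp.norm_apply_le (strainVec d G) (i, j)
  rw [strainVec_apply, Real.norm_eq_abs, abs_mul, abs_of_nonneg (Real.sqrt_nonneg _)] at h1
  have h2 : (gradMatrix G + (gradMatrix G).transpose) i j = 2 * strainRate (gradMatrix G) i j := by
    simp [strainRate]
  -- The entry bound would give the constant `2√2`; this cruder estimate rounds it up to `4`.
  have h3 : (1 / 2 : ℝ) ≤ √(1 / 2) := Real.le_sqrt_of_sq_le (by norm_num)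
  rw [h2, abs_mul, abs_two]
  simp only at h1
  nlinarith [abs_nonneg (strainRate (gradMatrix G) i j)]

/-- `A + Aᵀ` is symmetric, so swapping the summation indices shows that only the symmetric part of
`B` contributes. -/
lemma contraction_add_transpose (A B : Matrix (Fin d) (Fin d) ℝ) (c : ℝ) :
    contraction (c • (A + A.transpose)) B = 2 * c * contraction (strainRate A) (strainRate B) := by
  have h : ∑ i, ∑ j, (A i j + A j i) * B i j = ∑ i, ∑ j, (A i j + A j i) * B j i := by
    rw [Finset.sum_comm]
    simp only [add_comm]
  have e1 : contraction (c • (A + A.transpose)) B = c * ∑ i, ∑ j, (A i j + A j i) * B i j := by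
    simp [contraction, Finset.mul_sum, mul_assoc]
  have e2 : 2 * c * contraction (strainRate A) (strainRate B) =
      c / 2 * (∑ i, ∑ j, (A i j + A j i) * B i j + ∑ i, ∑ j, (A i j + A j i) * B j i) := by
    simp only [contraction, ← Finset.sum_add_distrib, Finset.mul_sum]
    refine Finset.sum_congr rfl fun i _ => Finset.sum_congr rfl fun j _ => ?_
    simp [strainRate]
    ring
  rw [e1, e2, ← h]
  ring

end Strain

end Viscoplastic

namespace Viscoplastic

/-! ### Integrals of `φ(‖a‖)` for square integrable `a` -/

section Integral

variable {α : Type*} [MeasurableSpace α] {μ : Measure α} (law : Rheology) {r y : α → ℝ}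
  {E : Type*} [NormedAddCommGroup E] [InnerProductSpace ℝ E] {a b : α → E}

omit [InnerProductSpace ℝ E] in
lemma aestronglyMeasurable_phi_norm (hrm : AEMeasurable r μ) (hym : AEMeasurable y μ)
    (ha : AEStronglyMeasurable a μ) :
    AEStronglyMeasurable (fun x => phi (r x) (y x) ‖a x‖ law) μ :=
  ((measurable_phi law).comp_aemeasurable
    (hrm.prodMk (hym.prodMk ha.norm.aemeasurable))).aestronglyMeasurable

omit [InnerProductSpace ℝ E] in
-- Comparison with `|φ(0)| + 2 y ‖a‖`, whose second term is a product of two `L²` functions.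
lemma integrable_phi_norm (hr : ∀ᵐ x ∂μ, 0 < r x) (hy : ∀ᵐ x ∂μ, 0 < y x)
    (hrm : AEMeasurable r μ) (hym : MemLp y 2 μ)
    (h0 : Integrable (fun x => phi (r x) (y x) 0 law) μ) (ha : MemLp a 2 μ) :
    Integrable (fun x => phi (r x) (y x) ‖a x‖ law) μ := by
  have hb : Integrable (fun x => 2 * (y x * ‖a x‖)) μ :=
    (hym.integrable_mul ha.norm).const_mul 2
  refine (h0.norm.add hb).mono'
    (aestronglyMeasurable_phi_norm law hrm hym.1.aemeasurable ha.1) ?_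
  filter_upwards [hr, hy] with x hrx hyx
  have h1 := abs_phi_sub_le law hrx hyx le_rfl (norm_nonneg (a x))
  rw [sub_zero, abs_norm] at h1
  have h2 := abs_sub_abs_le_abs_sub (phi (r x) (y x) ‖a x‖ law) (phi (r x) (y x) 0 law)
  simp only [Pi.add_apply, Real.norm_eq_abs]
  linarith

/-- Dominated differentiation with bound `2 y ‖b‖`. Measurability of the derivative is left as a
hypothesis because in the application it comes from integrability of the first variation. -/
lemma hasDerivAt_integral_phi_norm (hr : ∀ᵐ x ∂μ, 0 < r x) (hy : ∀ᵐ x ∂μ, 0 < y x)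
    (hrm : AEMeasurable r μ) (hym : MemLp y 2 μ)
    (h0 : Integrable (fun x => phi (r x) (y x) 0 law) μ) (ha : MemLp a 2 μ) (hb : MemLp b 2 μ)
    (hm : AEStronglyMeasurable
      (fun x => phiDeriv (r x) (y x) ‖a x‖ law * (inner ℝ (a x) (b x) / ‖a x‖)) μ) :
    HasDerivAt (fun t : ℝ => ∫ x, phi (r x) (y x) ‖a x + t • b x‖ law ∂μ)
      (∫ x, phiDeriv (r x) (y x) ‖a x‖ law * (inner ℝ (a x) (b x) / ‖a x‖) ∂μ) 0 := by
  have hab : ∀ t : ℝ, MemLp (fun x => a x + t • b x) 2 μ := fun t => ha.add (hb.const_smul t)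
  have hbd : Integrable (fun x => 2 * y x * ‖b x‖) μ := by
    simpa [mul_assoc] using (hym.integrable_mul hb.norm).const_mul 2
  refine (hasDerivAt_integral_of_dominated_loc_of_lip (s := Set.univ)
    (F := fun (t : ℝ) x => phi (r x) (y x) ‖a x + t • b x‖ law)
    (bound := fun x => 2 * y x * ‖b x‖) Filter.univ_mem
    (Filter.Eventually.of_forall fun t =>
      aestronglyMeasurable_phi_norm law hrm hym.1.aemeasurable (hab t).1)
    (integrable_phi_norm law hr hy hrm hym h0 (hab 0)) hm ?_ hbd ?_).2
  · filter_upwards [hr, hy] with x hrx hyx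
    exact (lipschitzWith_phi_norm_line law hrx hyx _ _).lipschitzOnWith
  · filter_upwards [hr, hy] with x hrx hyx
    exact hasDerivAt_phi_norm_line law hrx hyx _ _

lemma integrable_inner_of_memLp (ha : MemLp a 2 μ) (hb : MemLp b 2 μ) :
    Integrable (fun x => inner ℝ (a x) (b x)) μ :=
  (ha.norm.integrable_mul hb.norm).mono' (ha.1.inner hb.1)
    (Filter.Eventually.of_forall fun x => norm_inner_le_norm (a x) (b x))

lemma integral_phi_norm_comb_le (hr : ∀ᵐ x ∂μ, 0 < r x) (hy : ∀ᵐ x ∂μ, 0 < y x)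
    (hrm : AEMeasurable r μ) (hym : MemLp y 2 μ)
    (h0 : Integrable (fun x => phi (r x) (y x) 0 law) μ) (ha : MemLp a 2 μ) (hb : MemLp b 2 μ)
    {s t : ℝ} (hs : 0 ≤ s) (ht : 0 ≤ t) (hst : s + t = 1) :
    ∫ x, phi (r x) (y x) ‖s • a x + t • b x‖ law ∂μ ≤
      s * ∫ x, phi (r x) (y x) ‖a x‖ law ∂μ + t * ∫ x, phi (r x) (y x) ‖b x‖ law ∂μ := by
  have hA := (integrable_phi_norm law hr hy hrm hym h0 ha).const_mul s
  have hB := (integrable_phi_norm law hr hy hrm hym h0 hb).const_mul t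
  rw [← integral_const_mul, ← integral_const_mul, ← integral_add hA hB]
  refine integral_mono_ae (integrable_phi_norm law hr hy hrm hym h0
    ((ha.const_smul s).add (hb.const_smul t))) (hA.add hB) ?_
  filter_upwards [hr, hy] with x hrx hyx
  exact (convexOn_phi_norm law hrx hyx).2 (Set.mem_univ (a x)) (Set.mem_univ (b x)) hs ht hst

lemma integral_norm_sq_comb_le (ha : MemLp a 2 μ) (hb : MemLp b 2 μ)
    {s t : ℝ} (hs : 0 ≤ s) (ht : 0 ≤ t) (hst : s + t = 1) :
    ∫ x, ‖s • a x + t • b x‖ ^ 2 ∂μ ≤ s * ∫ x, ‖a x‖ ^ 2 ∂μ + t * ∫ x, ‖b x‖ ^ 2 ∂μ := by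
  have hA := ha.norm.integrable_sq.const_mul s
  have hB := hb.norm.integrable_sq.const_mul t
  rw [← integral_const_mul, ← integral_const_mul, ← integral_add hA hB]
  refine integral_mono ((ha.const_smul s).add (hb.const_smul t)).norm.integrable_sq
    (hA.add hB) fun x => ?_
  exact ((convexOn_univ_norm (E := E)).pow (fun _ _ => norm_nonneg _) 2).2
    (Set.mem_univ (a x)) (Set.mem_univ (b x)) hs ht hst

/-- The quadratic term is an exact polynomial in `t`, so its derivative needs no limit theorem. -/
lemma integral_norm_sq_line (ha : MemLp a 2 μ) (hb : MemLp b 2 μ) (t : ℝ) :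
    ∫ x, ‖a x + t • b x‖ ^ 2 ∂μ =
      ∫ x, ‖a x‖ ^ 2 ∂μ + 2 * t * ∫ x, inner ℝ (a x) (b x) ∂μ + t ^ 2 * ∫ x, ‖b x‖ ^ 2 ∂μ := by
  have h1 : Integrable (fun x => ‖a x‖ ^ 2) μ := ha.norm.integrable_sq
  have h2 : Integrable (fun x => ‖b x‖ ^ 2) μ := hb.norm.integrable_sq
  have h3 : Integrable (fun x => inner ℝ (a x) (b x)) μ := integrable_inner_of_memLp ha hb
  rw [← integral_const_mul, ← integral_const_mul, ← integral_add h1 (h3.const_mul _),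
    ← integral_add (by exact h1.add (h3.const_mul _)) (h2.const_mul _)]
  refine integral_congr_ae (Filter.Eventually.of_forall fun x => ?_)
  simp only [norm_add_sq_real, inner_smul_right, norm_smul, mul_pow, Real.norm_eq_abs, sq_abs]
  ring

lemma hasDerivAt_integral_norm_sq (ha : MemLp a 2 μ) (hb : MemLp b 2 μ) :
    HasDerivAt (fun t : ℝ => ∫ x, ‖a x + t • b x‖ ^ 2 ∂μ) (2 * ∫ x, inner ℝ (a x) (b x) ∂μ) 0 := by
  simp only [integral_norm_sq_line ha hb]
  have h1 := ((hasDerivAt_id (0 : ℝ)).const_mul 2).mul_const (∫ x, inner ℝ (a x) (b x) ∂μ)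
  have h2 := ((hasDerivAt_id (0 : ℝ)).pow 2).mul_const (∫ x, ‖b x‖ ^ 2 ∂μ)
  refine ((h1.const_add (∫ x, ‖a x‖ ^ 2 ∂μ)).add h2).congr_deriv ?_
  simp

/-- Integration against `g ∈ L²` of a linear functional of the values is continuous on `L²`. -/
lemma exists_clm_integral_mul {F : Type*} [NormedAddCommGroup F] [NormedSpace ℝ F] {g : α → ℝ}
    (hg : MemLp g 2 μ) (ℓ : F →L[ℝ] ℝ) :
    ∃ L : Lp F 2 μ →L[ℝ] ℝ, ∀ w : Lp F 2 μ, L w = ∫ x, g x * ℓ (w x) ∂μ := by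
  refine ⟨(innerSL ℝ (hg.toLp g)).comp (ℓ.compLpL 2 μ), fun w => ?_⟩
  change inner ℝ (hg.toLp g) (ℓ.compLpL 2 μ w) = _
  rw [L2.inner_def]
  refine integral_congr_ae ?_
  filter_upwards [hg.coeFn_toLp, ℓ.coeFn_compLpL w] with x h1 h2
  rw [h1, h2, RCLike.inner_apply, conj_trivial, mul_comm]

lemma exists_clm_integral_inner {f : α → E} (hf : MemLp f 2 μ) :
    ∃ L : Lp E 2 μ →L[ℝ] ℝ, ∀ w : Lp E 2 μ, L w = ∫ x, inner ℝ (f x) (w x) ∂μ := by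
  refine ⟨innerSL ℝ (hf.toLp f), fun w => ?_⟩
  change inner ℝ (hf.toLp f) w = _
  rw [L2.inner_def]
  refine integral_congr_ae ?_
  filter_upwards [hf.coeFn_toLp] with x h1
  rw [h1]

lemma integrable_contraction {d : ℕ} {S : α → Matrix (Fin d) (Fin d) ℝ}
    (hS : ∀ i j, MemLp (fun x => S x i j) 2 μ) {G : α → Jac d} (hG : MemLp G 2 μ) :
    Integrable (fun x => contraction (S x) (gradMatrix (G x))) μ :=
  integrable_finsetSum _ fun i _ => integrable_finsetSum _ fun j _ =>
    (hS i j).integrable_mul ((gradEntry i j).comp_memLp' hG)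

lemma exists_clm_integral_contraction {d : ℕ} {S : α → Matrix (Fin d) (Fin d) ℝ}
    (hS : ∀ i j, MemLp (fun x => S x i j) 2 μ) :
    ∃ L : Lp (Jac d) 2 μ →L[ℝ] ℝ,
      ∀ G : Lp (Jac d) 2 μ, L G = ∫ x, contraction (S x) (gradMatrix (G x)) ∂μ := by
  choose L hL using fun i j => exists_clm_integral_mul (hS i j) (gradEntry i j)
  refine ⟨∑ i, ∑ j, L i j, fun G => ?_⟩
  have hint : ∀ i j, Integrable (fun x => S x i j * gradMatrix (G x) i j) μ := fun i j =>
    (hS i j).integrable_mul ((gradEntry i j).comp_memLp' (Lp.memLp G))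
  simp only [contraction, _root_.sum_apply, hL, gradEntry_apply]
  rw [integral_finsetSum _ fun i _ => integrable_finsetSum _ fun j _ => hint i j]
  exact Finset.sum_congr rfl fun i _ => (integral_finsetSum _ fun j _ => hint i j).symm

end Integral

end Viscoplastic

namespace Viscoplastic

/-! ### Critical points of convex functionals -/

/-- On the line from `u` to `w`, `Φ` is a convex function of `t` with derivative zero at `0`, so its
slope from `0` to `1` is nonnegative. -/
lemma IsCriticalPoint.isMinOn {X : Type*} [AddCommGroup X] [Module ℝ X] {Φ : X → ℝ}
    {V : Submodule ℝ X} {u : X} (h : IsCriticalPoint Φ V u) (hΦ : ConvexOn ℝ Set.univ Φ) :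
    IsMinOn Φ V u := by
  intro w hw
  have hd : HasDerivAt (fun t : ℝ => Φ (u + t • (w - u))) 0 0 := h.2 _ (V.sub_mem hw h.1)
  have hc : ConvexOn ℝ Set.univ (fun t : ℝ => Φ (u + t • (w - u))) := by
    refine ⟨convex_univ, fun p _ q _ s t hs ht hst => ?_⟩
    have e : u + (s • p + t • q) • (w - u) = s • (u + p • (w - u)) + t • (u + q • (w - u)) := by
      have : u = s • u + t • u := by rw [← add_smul, hst, one_smul]
      rw [smul_add, smul_add, add_add_add_comm, ← this, add_smul, smul_smul, smul_smul,
        smul_eq_mul, smul_eq_mul]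
    simp only [e]
    exact hΦ.2 (Set.mem_univ _) (Set.mem_univ _) hs ht hst
  have h1 := hc.le_slope_of_hasDerivAt (Set.mem_univ 0) (Set.mem_univ 1) one_pos hd
  simpa [slope_def_field] using h1

lemma eq_zero_of_isMinOn {X : Type*} [AddCommGroup X] [Module ℝ X] {Φ : X → ℝ}
    {V : Submodule ℝ X} {u v : X} {c : ℝ} (h : IsMinOn Φ V u) (hu : u ∈ V) (hv : v ∈ V)
    (hd : HasLineDerivAt ℝ Φ c u v) : c = 0 := by
  refine IsLocalMin.hasDerivAt_eq_zero (Filter.Eventually.of_forall fun t => ?_) hd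
  simpa using h (V.add_mem hu (V.smul_mem t hv))

/-! ### Strain rates of Sobolev fields -/

section Sobolev

variable {d : ℕ} {Ω : Opens (Vec d)} (u v : H10 Ω)

lemma strainII_eq (x : Vec d) : strainII u x = ‖strainVec d (u.1.2 x)‖ :=
  secondInvariant_strainRate _

lemma contraction_strain (x : Vec d) : contraction (strain u x) (strain v x) =
    2 * inner ℝ (strainVec d (u.1.2 x)) (strainVec d (v.1.2 x)) :=
  contraction_strainRate _ _

lemma memLp_strainVec :
    MemLp (fun x => strainVec d (u.1.2 x)) 2 (volume.restrict (Ω : Set (Vec d))) :=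
  (strainVec d).comp_memLp' (Lp.memLp u.1.2)

lemma memLp_strainII : MemLp (strainII u) 2 (volume.restrict (Ω : Set (Vec d))) := by
  simpa only [← strainII_eq] using (memLp_strainVec u).norm

lemma memLp_vel : MemLp (vel u) 2 (volume.restrict (Ω : Set (Vec d))) := Lp.memLp u.1.1

lemma strainVec_comb (s t : ℝ) : ∀ᵐ x ∂(volume.restrict (Ω : Set (Vec d))),
    strainVec d ((s • u + t • v).1.2 x) =
      s • strainVec d (u.1.2 x) + t • strainVec d (v.1.2 x) := by
  filter_upwards [Lp.coeFn_add (s • u.1.2) (t • v.1.2), Lp.coeFn_smul s u.1.2,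
    Lp.coeFn_smul t v.1.2] with x h1 h2 h3
  have h4 : (s • u + t • v).1.2 x = s • u.1.2 x + t • v.1.2 x := by
    refine h1.trans ?_
    rw [Pi.add_apply, h2, h3, Pi.smul_apply, Pi.smul_apply]
  rw [h4, map_add, map_smul, map_smul]

lemma vel_comb (s t : ℝ) : ∀ᵐ x ∂(volume.restrict (Ω : Set (Vec d))),
    vel (s • u + t • v) x = s • vel u x + t • vel v x := by
  filter_upwards [Lp.coeFn_add (s • u.1.1) (t • v.1.1), Lp.coeFn_smul s u.1.1,
    Lp.coeFn_smul t v.1.1] with x h1 h2 h3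
  refine h1.trans ?_
  rw [Pi.add_apply, h2, h3, Pi.smul_apply, Pi.smul_apply]
  rfl

/-- General coefficients serve two purposes: `s + t = 1` for convexity, and `s = 1` for the
derivative along a line. -/
lemma energy_comb (law : Rheology) (m : ℝ) (μr τy : Vec d → ℝ) {f : Vec d → Vec d}
    (hf : MemLp f 2 (volume.restrict (Ω : Set (Vec d)))) (s t : ℝ) :
    energy Ω law m μr τy f (s • u + t • v) =
      (∫ x in (Ω : Set (Vec d)),
        phi (μr x) (τy x) ‖s • strainVec d (u.1.2 x) + t • strainVec d (v.1.2 x)‖ law)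
      + 2 * m * (∫ x in (Ω : Set (Vec d)),
        ‖s • strainVec d (u.1.2 x) + t • strainVec d (v.1.2 x)‖ ^ 2)
      - (s * (∫ x in (Ω : Set (Vec d)), inner ℝ (f x) (vel u x)) +
        t * ∫ x in (Ω : Set (Vec d)), inner ℝ (f x) (vel v x)) := by
  rw [← integral_const_mul s, ← integral_const_mul t,
    ← integral_add ((integrable_inner_of_memLp hf (memLp_vel u)).const_mul s)
      ((integrable_inner_of_memLp hf (memLp_vel v)).const_mul t)]
  simp only [energy, strainII_eq]
  congr 1
  · congr 1
    · refine integral_congr_ae ?_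
      filter_upwards [strainVec_comb u v s t] with x hx
      rw [hx]
    · congr 1
      refine integral_congr_ae ?_
      filter_upwards [strainVec_comb u v s t] with x hx
      rw [hx]
  · refine integral_congr_ae ?_
    filter_upwards [vel_comb u v s t] with x hx
    rw [hx, inner_add_right, inner_smul_right, inner_smul_right]

lemma energy_eq (law : Rheology) (m : ℝ) (μr τy : Vec d → ℝ) (f : Vec d → Vec d) :
    energy Ω law m μr τy f u =
      (∫ x in (Ω : Set (Vec d)), phi (μr x) (τy x) ‖strainVec d (u.1.2 x)‖ law)
      + 2 * m * (∫ x in (Ω : Set (Vec d)), ‖strainVec d (u.1.2 x)‖ ^ 2)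
      - ∫ x in (Ω : Set (Vec d)), inner ℝ (f x) (vel u x) := by
  simp only [energy, strainII_eq]

lemma phiVariation_eq (law : Rheology) (μr τy : Vec d → ℝ) (x : Vec d) :
    phiVariation law μr τy u v x = phiDeriv (μr x) (τy x) ‖strainVec d (u.1.2 x)‖ law *
      (inner ℝ (strainVec d (u.1.2 x)) (strainVec d (v.1.2 x)) / ‖strainVec d (u.1.2 x)‖) := by
  rw [phiVariation, strainII_eq, contraction_strain, mul_div_mul_left _ _ two_ne_zero]

lemma contraction_stress {law : Rheology} {m : ℝ} {μr τy : Vec d → ℝ}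
    (hm : law = .composite → m = 0) {x : Vec d} (hr : 0 < μr x) (hy : 0 < τy x) :
    contraction (stress law m μr τy u x) (grad v x) =
      phiVariation law μr τy u v x + 2 * m * contraction (strain u x) (strain v x) := by
  rw [stress, contraction_add_transpose, phiVariation_eq]
  change _ * contraction (strain u x) (strain v x) = _
  rw [contraction_strain, strainII_eq]
  -- Both sides vanish where the strain rate is zero; elsewhere `phiDeriv_div_add` applies, as it
  -- requires `s > 0`.
  rcases (norm_nonneg (strainVec d (u.1.2 x))).eq_or_lt with h | h
  · rw [norm_eq_zero.mp h.symm]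
    simp
  · rw [← phiDeriv_div_add law hm hr hy h]
    field_simp

end Sobolev

/-! ### The variational problem on `H¹₀(Ω)^d` -/

section Problem

variable {d : ℕ} {Ω : Opens (Vec d)} {law : Rheology} {m : ℝ} {μr τy : Vec d → ℝ}
  {f : Vec d → Vec d} (h0 : 0 ≤ m) (hm : law = .composite → m = 0)
  (hr : ∀ᵐ x ∂(volume.restrict (Ω : Set (Vec d))), 0 < μr x)
  (hy : ∀ᵐ x ∂(volume.restrict (Ω : Set (Vec d))), 0 < τy x)
  (hrm : AEMeasurable μr (volume.restrict (Ω : Set (Vec d))))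
  (hym : MemLp τy 2 (volume.restrict (Ω : Set (Vec d))))
  (hphi : IntegrableOn (fun x => phi (μr x) (τy x) 0 law) Ω volume)
  (hf : MemLp f 2 (volume.restrict (Ω : Set (Vec d))))

include h0 hm hr hy hrm hym in
lemma memLp_stress (u : H10 Ω) (i j : Fin d) :
    MemLp (fun x => stress law m μr τy u x i j) 2 (volume.restrict (Ω : Set (Vec d))) := by
  have hs := memLp_strainII u
  have hG : ∀ i j : Fin d, MemLp (fun x => gradMatrix (u.1.2 x) i j) 2
      (volume.restrict (Ω : Set (Vec d))) := fun i j =>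
    (gradEntry i j).comp_memLp' (Lp.memLp u.1.2)
  have hmeas : AEStronglyMeasurable (fun x => stress law m μr τy u x i j)
      (volume.restrict (Ω : Set (Vec d))) :=
    (((measurable_viscosity law m).comp_aemeasurable
      (hrm.prodMk (hym.1.aemeasurable.prodMk hs.1.aemeasurable))).mul
        ((hG i j).add (hG j i)).1.aemeasurable).aestronglyMeasurable
  refine MemLp.mono' ((hym.add (hs.const_mul m)).const_mul 4) hmeas ?_
  filter_upwards [hr, hy] with x hrx hyx
  have hn : 0 ≤ strainII u x := Real.sqrt_nonneg _
  have h1 := viscosity_nonneg law h0 hrx hyx hn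
  have h2 := viscosity_mul_le law hm hrx hyx hn
  have h3 := abs_symGrad_le (u.1.2 x) i j
  rw [← strainII_eq] at h3
  have e : stress law m μr τy u x i j = viscosity m (μr x) (τy x) (strainII u x) law *
    (gradMatrix (u.1.2 x) + (gradMatrix (u.1.2 x)).transpose) i j := rfl
  rw [e, Real.norm_eq_abs, abs_mul, abs_of_nonneg h1]
  simp only [Pi.add_apply]
  calc _ ≤ viscosity m (μr x) (τy x) (strainII u x) law * (4 * strainII u x) := by gcongr
    _ ≤ _ := by linarith

include h0 hm hr hy hrm hym in
lemma integrable_contraction_stress (u v : H10 Ω) :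
    Integrable (fun x => contraction (stress law m μr τy u x) (grad v x))
      (volume.restrict (Ω : Set (Vec d))) :=
  integrable_contraction (memLp_stress h0 hm hr hy hrm hym u) (Lp.memLp v.1.2)

lemma integrable_contraction_strain (u v : H10 Ω) :
    Integrable (fun x => contraction (strain u x) (strain v x))
      (volume.restrict (Ω : Set (Vec d))) := by
  simp only [contraction_strain]
  exact (integrable_inner_of_memLp (memLp_strainVec u) (memLp_strainVec v)).const_mul 2

include h0 hm hr hy hrm hym in
-- By `contraction_stress` the integrand is a.e. a difference of two integrable functions, which
-- settles its measurability as well.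
lemma integrable_phiVariation (u v : H10 Ω) :
    Integrable (phiVariation law μr τy u v) (volume.restrict (Ω : Set (Vec d))) := by
  refine ((integrable_contraction_stress h0 hm hr hy hrm hym u v).sub
    ((integrable_contraction_strain u v).const_mul (2 * m))).congr ?_
  filter_upwards [hr, hy] with x hrx hyx
  rw [Pi.sub_apply, contraction_stress u v hm hrx hyx, add_sub_cancel_right]

include h0 hm hr hy hrm hym in
lemma firstVariation_eq_weakResidual (u v : H10 Ω) :
    firstVariation Ω law m μr τy f u v = weakResidual Ω law m μr τy f u v := by
  rw [firstVariation, weakResidual,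
    ← integral_add (integrable_phiVariation h0 hm hr hy hrm hym u v)
      ((integrable_contraction_strain u v).const_mul (2 * m))]
  congr 1
  refine integral_congr_ae ?_
  filter_upwards [hr, hy] with x hrx hyx
  exact (contraction_stress u v hm hrx hyx).symm

include h0 hr hy hrm hym hphi hf in
lemma convexOn_energy : ConvexOn ℝ Set.univ (energy Ω law m μr τy f) := by
  refine ⟨convex_univ, fun u _ v _ s t hs ht hst => ?_⟩
  have h1 := integral_phi_norm_comb_le law hr hy hrm hym hphi (memLp_strainVec u)
    (memLp_strainVec v) hs ht hst
  have h2 := mul_le_mul_of_nonneg_left (integral_norm_sq_comb_le (memLp_strainVec u)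
    (memLp_strainVec v) hs ht hst) (by positivity : 0 ≤ 2 * m)
  rw [energy_comb u v law m μr τy hf, energy_eq, energy_eq, smul_eq_mul, smul_eq_mul]
  linarith

include h0 hm hr hy hrm hym hphi hf in
lemma hasLineDerivAt_energy (u v : H10 Ω) :
    HasLineDerivAt ℝ (energy Ω law m μr τy f) (firstVariation Ω law m μr τy f u v) u v := by
  have hmeas := (integrable_phiVariation h0 hm hr hy hrm hym u v).1
  simp only [funext (phiVariation_eq u v law μr τy)] at hmeas
  have h1 := hasDerivAt_integral_phi_norm law hr hy hrm hym hphi (memLp_strainVec u)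
    (memLp_strainVec v) hmeas
  have h2 := (hasDerivAt_integral_norm_sq (memLp_strainVec u) (memLp_strainVec v)).const_mul (2 * m)
  have h3 := ((hasDerivAt_id (0 : ℝ)).mul_const
    (∫ x in (Ω : Set (Vec d)), inner ℝ (f x) (vel v x))).const_add
      (∫ x in (Ω : Set (Vec d)), inner ℝ (f x) (vel u x))
  have h4 := (h1.add h2).sub h3
  have e : ∀ t : ℝ, energy Ω law m μr τy f (u + t • v) = _ := fun t => by
    simpa only [one_smul, one_mul] using energy_comb u v law m μr τy hf 1 t
  unfold HasLineDerivAt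
  simp only [e]
  refine h4.congr_deriv ?_
  simp only [firstVariation, phiVariation_eq, contraction_strain, integral_const_mul, one_mul]

include h0 hm hr hy hrm hym hf in
-- The functional is built on all of `L2Pair Ω`, not only on `H10 Ω`, so that it can be restricted
-- to `H10 Ω` and also used in the closure argument for the pressure.
lemma exists_clm_weakResidual (u : H10 Ω) : ∃ L : L2Pair Ω →L[ℝ] ℝ, ∀ w : L2Pair Ω,
    L w = (∫ x in (Ω : Set (Vec d)), contraction (stress law m μr τy u x) (gradMatrix (w.2 x)))
      - ∫ x in (Ω : Set (Vec d)), inner ℝ (f x) (w.1 x) := by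
  obtain ⟨L₁, h₁⟩ := exists_clm_integral_contraction (memLp_stress h0 hm hr hy hrm hym u)
  obtain ⟨L₂, h₂⟩ := exists_clm_integral_inner hf
  refine ⟨L₁.comp (ContinuousLinearMap.snd ℝ _ _) - L₂.comp (ContinuousLinearMap.fst ℝ _ _),
    fun w => ?_⟩
  rw [← h₁, ← h₂]
  rfl

include h0 hm hr hy hrm hym hf in
lemma IsStokesPair.isVelocitySolution {u : H10 Ω} {p : Vec d → ℝ}
    (hp : MemLp p 2 (volume.restrict (Ω : Set (Vec d))))
    (h : IsStokesPair Ω law m μr τy f u p) : IsVelocitySolution Ω law m μr τy f u := by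
  refine ⟨h.1, fun v hv => ?_⟩
  obtain ⟨L, hL⟩ := exists_clm_weakResidual h0 hm hr hy hrm hym hf u
  obtain ⟨P, hP⟩ := exists_clm_integral_mul hp (∑ i : Fin d, gradEntry i i)
  have htr : ∀ G : Jac d, (∑ i : Fin d, gradEntry i i) G = (gradMatrix G).trace := fun G => by
    rw [_root_.sum_apply]
    rfl
  simp only [htr] at hP
  -- The residual minus the pressure term is continuous for the `L²` norms, so its kernel is closed;
  -- it contains the test fields by the momentum equation, hence their closure.
  have hle : (testFields Ω).topologicalClosure ≤
      (L - P.comp (ContinuousLinearMap.snd ℝ _ _)).ker := by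
    refine Submodule.topologicalClosure_minimal _ ?_ (ContinuousLinearMap.isClosed_ker _)
    rintro w ⟨φ, h1, h2⟩
    have e1 : ∫ x in (Ω : Set (Vec d)),
          contraction (stress law m μr τy u x) (gradMatrix (w.2 x)) =
        ∫ x in (Ω : Set (Vec d)),
          contraction (stress law m μr τy u x) (gradMatrix (fderiv ℝ φ x)) := by
      refine integral_congr_ae ?_
      filter_upwards [h2] with x hx
      rw [hx]
    have e2 : ∫ x in (Ω : Set (Vec d)), p x * (gradMatrix (w.2 x)).trace =
        ∫ x in (Ω : Set (Vec d)), p x * (gradMatrix (fderiv ℝ φ x)).trace := by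
      refine integral_congr_ae ?_
      filter_upwards [h2] with x hx
      rw [hx]
    have e3 : ∫ x in (Ω : Set (Vec d)), inner ℝ (f x) (w.1 x) =
        ∫ x in (Ω : Set (Vec d)), inner ℝ (f x) (φ x) := by
      refine integral_congr_ae ?_
      filter_upwards [h1] with x hx
      rw [hx]
    change L w - P w.2 = 0
    rw [hL, hP, e1, e2, e3, ← h.2 φ]
    ring
  have hv0 : L v.1 - P v.1.2 = 0 := hle v.2.2
  have hPv : P v.1.2 = 0 := by
    rw [hP]
    refine integral_eq_zero_of_ae ?_
    filter_upwards [hv] with x hx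
    have hx' : (gradMatrix (v.1.2 x)).trace = 0 := hx
    simp [hx']
  rw [hPv, sub_zero, hL] at hv0
  exact hv0

end Problem

end Viscoplastic

theorem mainTheorem1 :
    -- `φ_i` and `φ_c` are convex `C¹` functions on `[0, ∞)` with the stated derivatives,
    -- and `φ'(σ) / (2 σ)` is twice the viscosity
    (∀ (law : Viscoplastic.Rheology) (r y : ℝ), 0 < r → 0 < y →
      ConvexOn ℝ (Set.Ici 0) (fun σ => Viscoplastic.phi r y σ law) ∧
      ContDiffOn ℝ 1 (fun σ => Viscoplastic.phi r y σ law) (Set.Ici 0) ∧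
      (∀ σ : ℝ, 0 ≤ σ → HasDerivWithinAt (fun s => Viscoplastic.phi r y s law)
        (Viscoplastic.phiDeriv r y σ law) (Set.Ici 0) σ) ∧
      (∀ m σ : ℝ, (law = Viscoplastic.Rheology.composite → m = 0) → 0 < σ →
        Viscoplastic.phiDeriv r y σ law / (2 * σ) + 2 * m =
          2 * Viscoplastic.viscosity m r y σ law)) ∧
    -- the variational structure of the nonlinear Stokes problem
    (∀ (d : ℕ) (Ω : TopologicalSpace.Opens (Viscoplastic.Vec d))
      (law : Viscoplastic.Rheology) (m : ℝ) (μr τy : Viscoplastic.Vec d → ℝ)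
      (f : Viscoplastic.Vec d → Viscoplastic.Vec d),
      IsConnected (Ω : Set (Viscoplastic.Vec d)) →
      0 ≤ m → (law = Viscoplastic.Rheology.composite → m = 0) →
      (∀ x ∈ Ω, 0 < μr x) → (∀ x ∈ Ω, 0 < τy x) →
      AEMeasurable μr (volume.restrict (Ω : Set (Viscoplastic.Vec d))) →
      MemLp τy 2 (volume.restrict (Ω : Set (Viscoplastic.Vec d))) →
      IntegrableOn (fun x => Viscoplastic.phi (μr x) (τy x) 0 law) Ω volume →
      MemLp f 2 (volume.restrict (Ω : Set (Viscoplastic.Vec d))) →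
      -- all the integrals converge
      (∀ u : Viscoplastic.H10 Ω,
        IntegrableOn (fun x =>
          Viscoplastic.phi (μr x) (τy x) (Viscoplastic.strainII u x) law) Ω volume ∧
        IntegrableOn (fun x => Viscoplastic.strainII u x ^ 2) Ω volume ∧
        IntegrableOn (fun x => inner ℝ (f x) (Viscoplastic.vel u x)) Ω volume) ∧
      (∀ u v : Viscoplastic.H10 Ω,
        IntegrableOn (Viscoplastic.phiVariation law μr τy u v) Ω volume ∧
        IntegrableOn (fun x => Viscoplastic.contraction (Viscoplastic.strain u x)
          (Viscoplastic.strain v x)) Ω volume ∧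
        IntegrableOn (fun x => Viscoplastic.contraction
          (Viscoplastic.stress law m μr τy u x) (Viscoplastic.grad v x)) Ω volume) ∧
      -- `Φ` is convex
      ConvexOn ℝ Set.univ (Viscoplastic.energy Ω law m μr τy f) ∧
      -- the Gateaux derivative of `Φ` is the weak form of the momentum equation
      (∀ u : Viscoplastic.H10 Ω, ∃ L : Viscoplastic.H10 Ω →L[ℝ] ℝ,
        ∀ v : Viscoplastic.H10 Ω,
          HasLineDerivAt ℝ (Viscoplastic.energy Ω law m μr τy f) (L v) u v ∧
          L v = Viscoplastic.firstVariation Ω law m μr τy f u v ∧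
          L v = Viscoplastic.weakResidual Ω law m μr τy f u v) ∧
      -- velocity solutions are the critical points, and these are the minimizers
      (∀ u : Viscoplastic.H10 Ω,
        (Viscoplastic.IsVelocitySolution Ω law m μr τy f u ↔
          Viscoplastic.IsCriticalPoint (Viscoplastic.energy Ω law m μr τy f)
            (Viscoplastic.solenoidal Ω) u) ∧
        (Viscoplastic.IsCriticalPoint (Viscoplastic.energy Ω law m μr τy f)
            (Viscoplastic.solenoidal Ω) u ↔
          u ∈ Viscoplastic.solenoidal Ω ∧
            IsMinOn (Viscoplastic.energy Ω law m μr τy f) (Viscoplastic.solenoidal Ω) u)) ∧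
      -- the velocity of every velocity-pressure solution is a velocity solution
      (∀ (u : Viscoplastic.H10 Ω) (p : Viscoplastic.Vec d → ℝ),
        MemLp p 2 (volume.restrict (Ω : Set (Viscoplastic.Vec d))) →
        Viscoplastic.IsStokesPair Ω law m μr τy f u p →
        Viscoplastic.IsVelocitySolution Ω law m μr τy f u)) := by
  refine ⟨fun law r y hr hy => ⟨Viscoplastic.convexOn_phi law hr hy,
    Viscoplastic.contDiffOn_phi law hr hy,
    fun σ hσ => (Viscoplastic.hasDerivAt_phi law hr hy hσ).hasDerivWithinAt,
    fun m σ hm hσ => Viscoplastic.phiDeriv_div_add law hm hr hy hσ⟩, ?_⟩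
  intro d Ω law m μr τy f _ h0 hm hr' hy' hrm hym hphi hf
  have hr : ∀ᵐ x ∂(volume.restrict (Ω : Set (Viscoplastic.Vec d))), 0 < μr x :=
    (ae_restrict_mem Ω.isOpen.measurableSet).mono hr'
  have hy : ∀ᵐ x ∂(volume.restrict (Ω : Set (Viscoplastic.Vec d))), 0 < τy x :=
    (ae_restrict_mem Ω.isOpen.measurableSet).mono hy'
  have hconv := Viscoplastic.convexOn_energy h0 hr hy hrm hym hphi hf
  have hline := Viscoplastic.hasLineDerivAt_energy h0 hm hr hy hrm hym hphi hf
  have hres := Viscoplastic.firstVariation_eq_weakResidual (f := f) h0 hm hr hy hrm hym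
  refine ⟨fun u => ⟨?_, (Viscoplastic.memLp_strainII u).integrable_sq,
    Viscoplastic.integrable_inner_of_memLp hf (Viscoplastic.memLp_vel u)⟩,
    fun u v => ⟨Viscoplastic.integrable_phiVariation h0 hm hr hy hrm hym u v,
      Viscoplastic.integrable_contraction_strain u v,
      Viscoplastic.integrable_contraction_stress h0 hm hr hy hrm hym u v⟩,
    hconv, fun u => ?_, fun u => ⟨?_, ?_⟩,
    fun u p hp h => h.isVelocitySolution h0 hm hr hy hrm hym hf hp⟩
  · simp only [Viscoplastic.strainII_eq]
    exact Viscoplastic.integrable_phi_norm law hr hy hrm hym hphi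
      (Viscoplastic.memLp_strainVec u)
  · obtain ⟨L, hL⟩ := Viscoplastic.exists_clm_weakResidual h0 hm hr hy hrm hym hf u
    refine ⟨L.comp (Viscoplastic.H10 Ω).subtypeL, fun v => ?_⟩
    have e : L.comp (Viscoplastic.H10 Ω).subtypeL v =
      Viscoplastic.weakResidual Ω law m μr τy f u v := hL v.1
    rw [e, ← hres]
    exact ⟨hline u v, rfl, rfl⟩
  · refine and_congr_right fun _ => forall₂_congr fun v _ => ?_
    rw [← hres]
    -- The residual is the line derivative of `Φ`; by uniqueness of derivatives it vanishes exactly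
    -- when that derivative is zero.
    exact ⟨fun h => h ▸ hline u v, fun h => (hline u v).unique h⟩
  · refine ⟨fun h => ⟨h.1, h.isMinOn hconv⟩, fun h => ⟨h.1, fun v hv => ?_⟩⟩
    have := hline u v
    rwa [Viscoplastic.eq_zero_of_isMinOn h.2 h.1 hv this] at this
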